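/- Let $m\ge 0$ and let $v\in\mathbb{R}^{m+1}$ be a unit vector. Let $x:\Sigma^m\to\mathbb{R}^{m+1}$ be a translator of the mean curvature flow with velocity $v$, i.e. a smooth isometric immersion of a connected, complete Riemannian manifold $\Sigma$ of dimension $m$ (without boundary) whose mean curvature vector $\mathbf{H}=\mathrm{tr}(\mathbf{A})$, with $\mathbf{A}=D\,dx$ the second fundamental form, satisfies $\mathbf{H}=v^{\perp}$, where $v^\perp$ denotes the component of $v$ normal to $\Sigma$. Put $f=-\langle x,v\rangle$ and let $\Delta_f=\Delta-\langle\nabla f,\nabla\,\cdot\,\rangle$ be the $f$-Laplacian on $\Sigma$. Assume that $\Sigma$ is $f$-stochastically complete, i.e. that the diffusion process on $\Sigma$ generated by $\Delta_f$ has, from every starting point, almost surely infinite lifetime (equivalently: for every $p\in\Sigma$ there is a process with continuous paths $[0,\infty)\to\Sigma$, starting at $p$, that solves the martingale problem for $\Delta_f$ on $C_c^\infty(\Sigma)$). Then for no $b\in\mathbb{R}$ is $x(\Sigma)$ contained in the lower halfspace $\{p\in\mathbb{R}^{m+1}:\langle p,v\rangle\le b\}$. In particular, $x(\Sigma)$ is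 not bounded. -/

import Mathlib

open MeasureTheory ProbabilityTheory Set Bundle
open scoped Manifold ContDiff NNReal

noncomputable section

namespace TranslatorMCF

universe u

/-- Euclidean space `ℝ^n`. -/
abbrev Euc (n : ℕ) : Type := EuclideanSpace ℝ (Fin n)

/-- The `i`-th coordinate derivative of a function on (an open subset of) `ℝ^m`. -/
def coordDeriv {m : ℕ} {F : Type*} [NormedAddCommGroup F] [NormedSpace ℝ F]
    (i : Fin m) (h : Euc m → F) (y : Euc m) : F :=
  fderiv ℝ h y (EuclideanSpace.single i 1)

section Riemannian

/-! Local expressions, in the preferred chart around a point `c`, of the objects attached to the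
Riemannian metric of `M`. The variable `y` ranges over the image of that chart. -/

variable {m : ℕ} {M : Type u} [TopologicalSpace M] [ChartedSpace (Euc m) M]
  [RiemannianBundle (fun p : M ↦ TangentSpace (𝓡 m) p)]
  {F : Type*} [NormedAddCommGroup F] [NormedSpace ℝ F]

/-- The differential at `y` of the inverse of the chart around `c`; it maps the standard basis of
`ℝ^m` to the coordinate vectors `∂_1, …, ∂_m` at the point of `M` with coordinates `y`. -/
def chartSymmDeriv (c : M) (y : Euc m) :
    Euc m →L[ℝ] TangentSpace (𝓡 m) ((extChartAt (𝓡 m) c).symm y) :=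
  mfderiv 𝓘(ℝ, Euc m) (𝓡 m) (extChartAt (𝓡 m) c).symm y

/-- The metric coefficients `g_{ij} = ⟨∂_i, ∂_j⟩`. -/
def metricCoeff (c : M) (y : Euc m) : Matrix (Fin m) (Fin m) ℝ :=
  Matrix.of fun i j ↦ inner ℝ
    (chartSymmDeriv c y (EuclideanSpace.single i 1))
    (chartSymmDeriv c y (EuclideanSpace.single j 1))

/-- The Christoffel symbols `Γ^k_{ij}` of the Levi-Civita connection. -/
def christoffel (c : M) (y : Euc m) (k i j : Fin m) : ℝ :=
  (1 / 2 : ℝ) * ∑ l, (metricCoeff c y)⁻¹ k l *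
    (coordDeriv i (fun z ↦ metricCoeff c z j l) y
      + coordDeriv j (fun z ↦ metricCoeff c z i l) y
      - coordDeriv l (fun z ↦ metricCoeff c z i j) y)

/-- The coefficients `(D dw)_{ij} = ∂_i ∂_j w - Γ^k_{ij} ∂_k w` of the (generalized) Hessian of a
function `w` with values in a fixed vector space. -/
def hessCoeff (w : M → F) (c : M) (y : Euc m) (i j : Fin m) : F :=
  coordDeriv i (coordDeriv j (w ∘ (extChartAt (𝓡 m) c).symm)) y
    - ∑ k, christoffel c y k i j • coordDeriv k (w ∘ (extChartAt (𝓡 m) c).symm) y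

/-- The metric trace `g^{ij} (D dw)_{ij}` of the Hessian. -/
def traceHessInChart (w : M → F) (c : M) (y : Euc m) : F :=
  ∑ i, ∑ j, (metricCoeff c y)⁻¹ i j • hessCoeff w c y i j

/-- `⟨∇f, ∇w⟩ = g^{ij} ∂_i f ∂_j w`. -/
def gradInnerInChart (f w : M → ℝ) (c : M) (y : Euc m) : ℝ :=
  ∑ i, ∑ j, (metricCoeff c y)⁻¹ i j *
    (coordDeriv i (f ∘ (extChartAt (𝓡 m) c).symm) y
      * coordDeriv j (w ∘ (extChartAt (𝓡 m) c).symm) y)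

variable (m) in
/-- The weighted Laplacian `Δ_f w = Δ w - ⟨∇f, ∇w⟩` of the Riemannian manifold `M`. -/
def weightedLaplacian (f w : M → ℝ) (p : M) : ℝ :=
  traceHessInChart w p (extChartAt (𝓡 m) p p) - gradInnerInChart f w p (extChartAt (𝓡 m) p p)

variable (m) in
/-- The process `X`, on the filtered probability space `(Ω, ℱ, P)`, is a diffusion generated by
`Δ_f` that starts at `p` and lives in `M` for all times: it is adapted, has continuous paths
`[0, ∞) → M`, and solves the martingale problem for `Δ_f` on `C_c^∞(M)`. -/
structure IsDiffusionFrom (f : M → ℝ) (p : M) {Ω : Type*} [mΩ : MeasurableSpace Ω]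
    (P : Measure Ω) (ℱ : Filtration ℝ≥0 mΩ) (X : ℝ≥0 → Ω → M) : Prop where
  isProbabilityMeasure : IsProbabilityMeasure P
  adapted : ∀ t, Measurable[ℱ t, borel M] (X t)
  continuous_paths : ∀ o, Continuous fun t ↦ X t o
  start : ∀ᵐ o ∂P, X 0 o = p
  martingale : ∀ φ : M → ℝ, ContMDiff (𝓡 m) 𝓘(ℝ, ℝ) ∞ φ → HasCompactSupport φ →
    Martingale
      (fun t o ↦ φ (X t o) - ∫ s in (0 : ℝ)..t, weightedLaplacian m f φ (X s.toNNReal o)) ℱ P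

variable (m) in
/-- `f`-stochastic completeness: the diffusion generated by `Δ_f` does not explode. Since the
coefficients of `Δ_f` are smooth, its martingale problem is well posed up to the explosion time,
so the diffusion issued from `p` has almost surely infinite lifetime if and only if there is a
solution with continuous paths in `M` defined on all of `[0, ∞)`. (Taking `½ Δ_f` as the generator
only changes the speed of time.) -/
def IsStochasticallyComplete (f : M → ℝ) : Prop :=
  ∀ p : M, ∃ (Ω : Type u) (mΩ : MeasurableSpace Ω) (P : Measure Ω) (ℱ : Filtration ℝ≥0 mΩ)
    (X : ℝ≥0 → Ω → M), IsDiffusionFrom m f p P ℱ X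

end Riemannian

section Hypersurface

variable (m : ℕ) {M : Type u}

/-- The differential `dx_p : T_pM → ℝ^n`. -/
def differential {n : ℕ} [TopologicalSpace M] [ChartedSpace (Euc m) M] (x : M → Euc n) (p : M) :
    TangentSpace (𝓡 m) p →L[ℝ] Euc n :=
  mfderiv (𝓡 m) 𝓘(ℝ, Euc n) x p

/-- The component `w^⊥` of `w` normal to the immersed manifold at `p`. -/
def normalPart {n : ℕ} [TopologicalSpace M] [ChartedSpace (Euc m) M] (x : M → Euc n) (p : M)
    (w : Euc n) : Euc n :=
  (LinearMap.range (differential m x p).toLinearMap)ᗮ.starProjection w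

/-- The mean curvature vector `𝐇 = tr 𝐀`, where the second fundamental form `𝐀 = D dx` is the
generalized Hessian of the immersion `x`. -/
def meanCurvatureVector {n : ℕ} [TopologicalSpace M] [ChartedSpace (Euc m) M]
    [RiemannianBundle (fun p : M ↦ TangentSpace (𝓡 m) p)] (x : M → Euc n) (p : M) : Euc n :=
  traceHessInChart x p (extChartAt (𝓡 m) p p)

/-- `x : M → ℝ^{m+1}` is a translator with velocity `v`: a smooth isometric immersion of the
connected complete Riemannian manifold `M` such that `𝐇 = v^⊥`, where `|v| = 1`. -/
structure IsTranslator [EMetricSpace M] [ChartedSpace (Euc m) M]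
    [RiemannianBundle (fun p : M ↦ TangentSpace (𝓡 m) p)]
    (x : M → Euc (m + 1)) (v : Euc (m + 1)) : Prop where
  connected : ConnectedSpace M
  complete : CompleteSpace M
  smooth : ContMDiff (𝓡 m) 𝓘(ℝ, Euc (m + 1)) ∞ x
  isometric : ∀ (p : M) (X Y : TangentSpace (𝓡 m) p),
    inner ℝ (differential m x p X) (differential m x p Y) = inner ℝ X Y
  norm_velocity : ‖v‖ = 1
  translator_eq : ∀ p : M, meanCurvatureVector m x p = normalPart m x p v

end Hypersurface

end TranslatorMCF

end

/-! The height `u = ⟨x, v⟩` satisfies `Δ_f u = 1`: the trace of its Hessian is `⟨𝐇, v⟩ = |v^⊥|²`,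
and since `f = -u` the drift term contributes `|∇u|² = |v^⊤|²` (`weightedLaplacian_height`). Along
the diffusion the mean of `u` should therefore grow like `t`, which contradicts `u ≤ b` once the
process lives forever.

The martingale problem only admits compactly supported test functions, so `u - b` is multiplied by a
cutoff equal to one near a compact set `K`. The resulting martingale starts at `u p - b` when `p ∈
K`, and is at most `-r` at time `r` while the path stays near `K`. Stopping on exit from `K` gives
`u p - b ≤ -t · P(X stays in K up to t)` (`integral_le_neg_mul_measureReal`,
`sub_le_neg_mul_measureReal_stays`). Continuous paths on `[0, t]` have compact image, so exhausting
`M` by compact sets yields `u p - b ≤ -t` for every `t`, which is absurd.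

Optional stopping is used only in discrete time, on grids of mesh `t / (N + 1)` with `N → ∞`. -/

open Filter Topology

namespace TranslatorMCF

/-! ### Optional stopping along time grids -/

section Probability

variable {Ω : Type*} {mΩ : MeasurableSpace Ω} {P : Measure Ω}

/-- Optional stopping for a martingale in discrete time, in a form that survives passing to the
limit in the stopping time: the part of the stopped value above the level `L` is controlled by
the terminal value. -/
theorem integral_le_integral_min_stopped_add [IsFiniteMeasure P] {𝒢 : Filtration ℕ mΩ}
    {Y : ℕ → Ω → ℝ} (hY : Martingale Y 𝒢 P) {σ : Ω → ℕ}
    (hσ : IsStoppingTime 𝒢 fun o ↦ (σ o : WithTop ℕ)) {N : ℕ} (hσN : ∀ o, σ o ≤ N) (L : ℝ) :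
    Integrable (fun o ↦ Y (σ o) o) P ∧
    ∫ o, Y 0 o ∂P ≤ ∫ o, min (Y (σ o) o) L ∂P + ∫ o, max (Y N o - L) 0 ∂P := by
  have hσN' (o : Ω) : (σ o : WithTop ℕ) ≤ (N : WithTop ℕ) := WithTop.coe_le_coe.2 (hσN o)
  have hint : Integrable (fun o ↦ Y (σ o) o) P :=
    hY.submartingale.integrable_stoppedValue hσ hσN'
  have hstart : ∫ o, Y 0 o ∂P ≤ ∫ o, Y (σ o) o ∂P :=
    hY.submartingale.expected_stoppedValue_mono (isStoppingTime_const 𝒢 0) hσ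
      (fun o ↦ WithTop.coe_le_coe.2 (Nat.zero_le (σ o))) hσN'
  -- The positive part of a martingale is a submartingale, so the overshoot above `L` at time `σ` is
  -- dominated in mean by the overshoot at `N`, which does not involve `σ`.
  have hsub : Submartingale (fun n o ↦ max (Y n o - L) 0) 𝒢 P :=
    (hY.sub (martingale_const 𝒢 P L)).submartingale.pos
  have hend : ∫ o, max (Y (σ o) o - L) 0 ∂P ≤ ∫ o, max (Y N o - L) 0 ∂P :=
    hsub.expected_stoppedValue_mono hσ (isStoppingTime_const 𝒢 N) hσN'
      (fun o ↦ le_refl (N : WithTop ℕ))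
  have hmin : Integrable (fun o ↦ min (Y (σ o) o) L) P := hint.inf (integrable_const L)
  have hmax : Integrable (fun o ↦ max (Y (σ o) o - L) 0) P :=
    (hint.sub (integrable_const L)).sup (integrable_zero _ _ _)
  have hsplit : ∫ o, Y (σ o) o ∂P
      = ∫ o, min (Y (σ o) o) L ∂P + ∫ o, max (Y (σ o) o - L) 0 ∂P := by
    rw [← integral_add hmin hmax]
    refine integral_congr_ae (ae_of_all _ fun o ↦ ?_)
    rcases le_total (Y (σ o) o) L with h | h <;> simp [h]
  exact ⟨hint, by linarith⟩

theorem tendsto_integral_max_sub_natCast {Y : Ω → ℝ} (hY : Integrable Y P) :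
    Tendsto (fun n : ℕ ↦ ∫ o, max (Y o - n) 0 ∂P) atTop (𝓝 0) := by
  have h := tendsto_integral_of_dominated_convergence (μ := P)
    (F := fun (n : ℕ) o ↦ max (Y o - n) 0) (f := fun _ ↦ 0) (fun o ↦ |Y o|)
    (fun n ↦ (hY.aestronglyMeasurable.sub aestronglyMeasurable_const).sup
      aestronglyMeasurable_const) hY.abs ?_ ?_
  · simpa using h
  · refine fun n ↦ ae_of_all _ fun o ↦ ?_
    have hn : (0 : ℝ) ≤ n := n.cast_nonneg
    rw [Real.norm_eq_abs, abs_of_nonneg (le_max_right _ _)]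
    exact max_le (by linarith [le_abs_self (Y o)]) (abs_nonneg _)
  · refine ae_of_all _ fun o ↦ ?_
    obtain ⟨n₀, hn₀⟩ := exists_nat_ge (Y o)
    refine tendsto_const_nhds.congr' ?_
    filter_upwards [eventually_ge_atTop n₀] with n hn
    have : (n₀ : ℝ) ≤ n := by exact_mod_cast hn
    rw [max_eq_right (by linarith)]

/-- The filtration `ℱ` observed at the multiples of `d`. -/
def gridFiltration (ℱ : Filtration ℝ≥0 mΩ) (d : ℝ≥0) : Filtration ℕ mΩ where
  seq k := ℱ (k * d)
  mono' i j hij := ℱ.mono (by gcongr)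
  le' k := ℱ.le _

theorem martingale_grid {ℱ : Filtration ℝ≥0 mΩ} {Z : ℝ≥0 → Ω → ℝ} (hZ : Martingale Z ℱ P)
    (d : ℝ≥0) : Martingale (fun k : ℕ ↦ Z (k * d)) (gridFiltration ℱ d) P :=
  ⟨fun k ↦ hZ.1 (k * d), fun i j hij ↦ hZ.2 (i * d) (j * d) (by gcongr)⟩

variable {M : Type*} [EMetricSpace M]

/-- A continuous path that is in a compact set `K` at all grid times before `r` stays in a given
neighbourhood of `K` up to time `r`, if the grid is fine enough. -/
theorem eventually_forall_mem_of_grid_mem {γ : ℝ≥0 → M} (hγ : Continuous γ) {K U : Set M}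
    (hK : IsCompact K) (hU : IsOpen U) (hKU : K ⊆ U) (t : ℝ≥0) :
    ∀ᶠ N : ℕ in atTop, ∀ j ≤ N + 1, 0 < j →
      (∀ k < j, γ (k * (t / ((N : ℝ≥0) + 1))) ∈ K) →
      ∀ s ≤ j * (t / ((N : ℝ≥0) + 1)), γ s ∈ U := by
  obtain ⟨δ, hδ, hδU⟩ := hK.exists_thickening_subset_open hU hKU
  have huc : UniformContinuousOn γ (Icc 0 t) :=
    isCompact_Icc.uniformContinuousOn_of_continuous hγ.continuousOn
  obtain ⟨ε, hε, hεδ⟩ := EMetric.uniformContinuousOn_iff.1 huc (ENNReal.ofReal δ) (by simpa)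
  have hlim : Tendsto (fun N : ℕ ↦ ((t / ((N : ℝ≥0) + 1) : ℝ≥0) : ENNReal)) atTop (𝓝 0) := by
    rw [← ENNReal.coe_zero, ENNReal.tendsto_coe]
    have h := (tendsto_one_div_add_atTop_nhds_zero_nat (𝕜 := ℝ≥0)).const_mul t
    simpa [div_eq_mul_inv] using h
  filter_upwards [hlim.eventually_lt_const hε] with N hN j hjN hj hk s hs
  set d : ℝ≥0 := t / ((N : ℝ≥0) + 1) with hd
  have hNd : ((N : ℝ≥0) + 1) * d = t := mul_div_cancel₀ _ (by positivity)
  have hjd : (j : ℝ≥0) * d ≤ t := by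
    rw [← hNd]
    gcongr
    exact_mod_cast hjN
  -- The cell containing `s` is closed on the right, so `s = j * d` is attached to `k = j - 1`:
  -- nothing is known about the path at time `j * d` itself.
  obtain ⟨k, hkj, hks, hsk⟩ : ∃ k < j, (k : ℝ≥0) * d ≤ s ∧ s ≤ k * d + d := by
    clear hk hjN hjd
    induction j with
    | zero => omega
    | succ j ih =>
      rcases le_or_gt (j * d) s with h | h
      · exact ⟨j, by omega, h, by push_cast at hs; linarith⟩
      · rcases Nat.eq_zero_or_pos j with rfl | hj0
        · simp at h
        · obtain ⟨k, h1, h2⟩ := ih hj0 h.le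
          exact ⟨k, by omega, h2⟩
  refine hδU ((Metric.mem_thickening_iff_exists_edist_lt _ _).2 ⟨_, hk k hkj, ?_⟩)
  refine hεδ ⟨zero_le, hs.trans hjd⟩ ⟨zero_le, hks.trans (hs.trans hjd)⟩ ?_
  refine lt_of_le_of_lt ?_ hN
  rw [edist_nndist, ENNReal.coe_le_coe]
  rw [← NNReal.coe_le_coe, coe_nndist, NNReal.dist_eq, abs_of_nonneg (sub_nonneg.2 (by exact_mod_cast hks))]
  have : (s : ℝ) ≤ (k * d : ℝ≥0) + d := by exact_mod_cast hsk
  linarith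

/-- If a martingale `Z` is at most `-r` at time `r` as long as the continuous path `X` has stayed
in a neighbourhood of a compact set `K`, then its mean is at most `-t` times the
probability that `X` stays in `K` up to time `t`. -/
theorem integral_le_neg_mul_measureReal [IsProbabilityMeasure P] {ℱ : Filtration ℝ≥0 mΩ}
    {X : ℝ≥0 → Ω → M} (hXm : ∀ t, Measurable[ℱ t, borel M] (X t))
    (hXc : ∀ o, Continuous fun t ↦ X t o) {Z : ℝ≥0 → Ω → ℝ} (hZ : Martingale Z ℱ P)
    {K U : Set M} (hK : IsCompact K) (hU : IsOpen U) (hKU : K ⊆ U)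
    (hZ0 : ∀ o, Z 0 o ≤ 0)
    (hZU : ∀ o r, (∀ s ≤ r, X s o ∈ U) → Z r o ≤ -r) {t : ℝ≥0} {A : Set Ω}
    (hA : MeasurableSet A) (hAK : ∀ o ∈ A, ∀ s ≤ t, X s o ∈ K) :
    ∫ o, Z 0 o ∂P ≤ -(t * P.real A) := by
  let d : ℕ → ℝ≥0 := fun N ↦ t / ((N : ℝ≥0) + 1)
  have hNd (N : ℕ) : (((N + 1 : ℕ) : ℝ≥0)) * d N = t := by
    push_cast
    exact mul_div_cancel₀ _ (by positivity)
  -- First grid time outside `K`, capped at index `N + 1`, which is time `t`.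
  let σ : ℕ → Ω → ℕ := fun N ↦ hittingBtwn (fun (k : ℕ) o ↦ X (k * d N) o) Kᶜ 0 (N + 1)
  have hσN (N : ℕ) (o : Ω) : σ N o ≤ N + 1 := hittingBtwn_le o
  have hσ (N : ℕ) : IsStoppingTime (gridFiltration ℱ (d N)) (fun o ↦ (σ N o : WithTop ℕ)) := by
    let _ : MeasurableSpace M := borel M
    have _ : BorelSpace M := ⟨rfl⟩
    exact Adapted.isStoppingTime_hittingBtwn (f := gridFiltration ℱ (d N))
      (u := fun (k : ℕ) o ↦ X (k * d N) o)
      (fun k ↦ hXm (k * d N)) hK.isClosed.measurableSet.compl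
  let Y : ℕ → Ω → ℝ := fun N o ↦ Z (σ N o * d N) o
  have hYint (N : ℕ) : Integrable (Y N) P :=
    (integral_le_integral_min_stopped_add (martingale_grid hZ (d N)) (hσ N) (hσN N) 0).1
  have hYle (N L : ℕ) :
      ∫ o, Z 0 o ∂P ≤ ∫ o, min (Y N o) L ∂P + ∫ o, max (Z t o - L) 0 ∂P := by
    have h := (integral_le_integral_min_stopped_add (martingale_grid hZ (d N)) (hσ N) (hσN N) L).2
    simp only [hNd, Nat.cast_zero, zero_mul] at h
    exact h
  have hev (o : Ω) : ∀ᶠ N : ℕ in atTop, Y N o ≤ A.indicator (fun _ ↦ -(t : ℝ)) o := by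
    filter_upwards [eventually_forall_mem_of_grid_mem (hXc o) hK hU hKU t] with N hN
    have hYσ : Y N o ≤ -((σ N o * d N : ℝ≥0) : ℝ) := by
      rcases Nat.eq_zero_or_pos (σ N o) with h0 | hpos
      · simpa [Y, h0] using hZ0 o
      · refine hZU o _ (hN _ (hσN N o) hpos fun k hk ↦ ?_)
        have := notMem_of_lt_hittingBtwn hk (Nat.zero_le k)
        simpa using this
    by_cases hoA : o ∈ A
    · have hσeq : σ N o = N + 1 := by
        by_contra hne
        have hlt : σ N o < N + 1 := lt_of_le_of_ne (hσN N o) hne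
        have hmem := hittingBtwn_mem_set_of_hittingBtwn_lt hlt
        refine hmem (hAK o hoA _ ?_)
        rw [← hNd N]
        have := hσN N o
        gcongr
      rw [hσeq, hNd] at hYσ
      simpa [hoA] using hYσ
    · simp only [hoA, not_false_eq_true, indicator_of_notMem]
      exact hYσ.trans (neg_nonpos.2 (NNReal.coe_nonneg _))
  have hbound (L : ℕ) :
      ∫ o, Z 0 o ∂P ≤ -(t * P.real A) + ∫ o, max (Z t o - L) 0 ∂P := by
    let a : Ω → ℝ := A.indicator (fun _ ↦ -(t : ℝ))
    have ha : Integrable a P := (integrable_const _).indicator hA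
    have ha0 (o : Ω) : a o ≤ 0 := indicator_apply_nonpos fun _ ↦ neg_nonpos.2 t.coe_nonneg
    have hat (o : Ω) : -(t : ℝ) ≤ a o := by
      by_cases h : o ∈ A <;> simp [a, h]
    have hL : (0 : ℝ) ≤ L := L.cast_nonneg
    -- The `Y N` have no common integrable bound. Truncating above by `L` and below by `a` bounds
    -- the integrand by `t + L`, and since `Y N ≤ a` eventually, it is eventually equal to `a`.
    have hWint (N : ℕ) : Integrable (fun o ↦ max (min (Y N o) L) (a o)) P :=
      ((hYint N).inf (integrable_const _)).sup ha
    have hlim : Tendsto (fun N ↦ ∫ o, max (min (Y N o) L) (a o) ∂P) atTop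
        (𝓝 (∫ o, a o ∂P)) := by
      refine tendsto_integral_of_dominated_convergence (fun _ ↦ (t : ℝ) + L)
        (fun N ↦ (hWint N).aestronglyMeasurable) (integrable_const _)
        (fun N ↦ ae_of_all _ fun o ↦ ?_) (ae_of_all _ fun o ↦ ?_)
      · rw [Real.norm_eq_abs, abs_le]
        have ht : (0 : ℝ) ≤ t := t.coe_nonneg
        constructor
        · linarith [le_max_right (min (Y N o) (L : ℝ)) (a o), hat o]
        · exact max_le ((min_le_right _ _).trans (by linarith)) (by linarith [ha0 o])
      · refine tendsto_const_nhds.congr' ?_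
        filter_upwards [hev o] with N hN
        rw [max_eq_right ((min_le_left _ _).trans hN)]
    have haint : ∫ o, a o ∂P = -(t * P.real A) := by
      rw [integral_indicator hA, setIntegral_const, smul_eq_mul]
      ring
    rw [← haint]
    refine ge_of_tendsto' (hlim.add_const _) fun N ↦ (hYle N L).trans ?_
    have hmin : Integrable (fun o ↦ min (Y N o) (L : ℝ)) P := (hYint N).inf (integrable_const _)
    have hmono := integral_mono hmin (hWint N) fun o ↦ le_max_left _ _
    linarith
  -- Only after `N → ∞` is the truncation level `L` sent to infinity.
  have hlim := (tendsto_integral_max_sub_natCast (hZ.integrable t)).const_add (-(t * P.real A))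
  rw [add_zero] at hlim
  exact ge_of_tendsto' hlim hbound

/-- By path continuity and closedness of `K`, countably many times suffice: a dense sequence clipped
at `t`. -/
theorem measurableSet_forall_le_mem {X : ℝ≥0 → Ω → M} (hXm : ∀ t, Measurable[mΩ, borel M] (X t))
    (hXc : ∀ o, Continuous fun t ↦ X t o) {K : Set M} (hK : IsClosed K) (t : ℝ≥0) :
    MeasurableSet {o | ∀ s ≤ t, X s o ∈ K} := by
  let _ : MeasurableSpace M := borel M
  have _ : BorelSpace M := ⟨rfl⟩
  have heq : {o | ∀ s ≤ t, X s o ∈ K}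
      = ⋂ n : ℕ, X (min (TopologicalSpace.denseSeq ℝ≥0 n) t) ⁻¹' K := by
    ext o
    simp only [mem_ofPred_eq, mem_iInter, mem_preimage]
    refine ⟨fun h n ↦ h _ (min_le_right _ _), fun h s hs ↦ ?_⟩
    have hcl : IsClosed {r : ℝ≥0 | X (min r t) o ∈ K} :=
      hK.preimage ((hXc o).comp (continuous_id.min continuous_const))
    have hall := (TopologicalSpace.denseRange_denseSeq ℝ≥0).induction_on
      (p := fun r ↦ X (min r t) o ∈ K) s hcl h
    rwa [min_eq_left hs] at hall
  rw [heq]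
  exact MeasurableSet.iInter fun n ↦ hXm _ hK.measurableSet

end Probability

/-! ### The height function of a translator -/

section Geometry

/-- If `w = ∑ c k • a k` and `G` is the Gram matrix, the inner products form the vector `G c`, and
`(G c)ᵀ G⁻¹ (G c) = cᵀ G c = ‖w‖²`. -/
theorem sum_gram_inv_mul_inner_mul_inner {n : ℕ} {E : Type*} [NormedAddCommGroup E]
    [InnerProductSpace ℝ E] {a : Fin n → E} (ha : LinearIndependent ℝ a) {w : E}
    (hw : w ∈ Submodule.span ℝ (range a)) :
    ∑ i, ∑ j, (Matrix.gram ℝ a)⁻¹ i j * (inner ℝ (a i) w * inner ℝ (a j) w) = ‖w‖ ^ 2 := by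
  obtain ⟨c, rfl⟩ := (Submodule.mem_span_range_iff_exists_fun ℝ).1 hw
  have hdet : IsUnit (Matrix.gram ℝ a).det :=
    isUnit_iff_ne_zero.2 (Matrix.det_gram_ne_zero_iff_linearIndependent.2 ha)
  have hb (i : Fin n) : inner ℝ (a i) (∑ k, c k • a k) = (Matrix.gram ℝ a).mulVec c i := by
    simp [inner_sum, inner_smul_right, Matrix.mulVec, dotProduct, mul_comm]
  have hc : (Matrix.gram ℝ a)⁻¹.mulVec ((Matrix.gram ℝ a).mulVec c) = c := by
    rw [Matrix.mulVec_mulVec, Matrix.nonsing_inv_mul _ hdet, Matrix.one_mulVec]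
  simp only [hb]
  calc _ = (Matrix.gram ℝ a).mulVec c ⬝ᵥ
        (Matrix.gram ℝ a)⁻¹.mulVec ((Matrix.gram ℝ a).mulVec c) := by
        generalize (Matrix.gram ℝ a).mulVec c = b
        simp only [dotProduct, Matrix.mulVec, Finset.mul_sum]
        exact Finset.sum_congr rfl fun i _ ↦ Finset.sum_congr rfl fun j _ ↦ by ring
    _ = _ := by
        rw [hc, dotProduct_comm, ← real_inner_self_eq_norm_sq]
        exact Matrix.star_dotProduct_gram_mulVec (𝕜 := ℝ) a c c

variable {m : ℕ} {M : Type*} [TopologicalSpace M] [ChartedSpace (Euc m) M]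

section
variable {F : Type*} [NormedAddCommGroup F] [NormedSpace ℝ F]

theorem coordDeriv_eventuallyEq {g h : Euc m → F} {y : Euc m} (hgh : g =ᶠ[𝓝 y] h) (i : Fin m) :
    coordDeriv i g =ᶠ[𝓝 y] coordDeriv i h :=
  (hgh.fderiv (𝕜 := ℝ)).mono fun z hz ↦ by simp only [coordDeriv, hz]

theorem coordDeriv_clm_comp {G : Type*} [NormedAddCommGroup G] [NormedSpace ℝ G] (ℓ : F →L[ℝ] G)
    {h : Euc m → F} {y : Euc m} (hh : DifferentiableAt ℝ h y) (i : Fin m) :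
    coordDeriv i (fun z ↦ ℓ (h z)) y = ℓ (coordDeriv i h y) := by
  have := (ℓ.hasFDerivAt.comp y hh.hasFDerivAt).fderiv
  simp only [coordDeriv]
  rw [show (fun z ↦ ℓ (h z)) = ℓ ∘ h from rfl, this]
  rfl

end

theorem contDiffAt_comp_extChartAt_symm [IsManifold (𝓡 m) ∞ M] {F : Type*} [NormedAddCommGroup F] [NormedSpace ℝ F]
    {x : M → F} (hx : ContMDiff (𝓡 m) 𝓘(ℝ, F) ∞ x) (c : M) :
    ContDiffAt ℝ ∞ (x ∘ (extChartAt (𝓡 m) c).symm) (extChartAt (𝓡 m) c c) := by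
  have h : ContMDiffAt 𝓘(ℝ, Euc m) (𝓡 m) ∞ (extChartAt (𝓡 m) c).symm (extChartAt (𝓡 m) c c) :=
    (contMDiffOn_extChartAt_symm c).contMDiffAt (extChartAt_target_mem_nhds c)
  exact (hx.contMDiffAt.comp _ h).contDiffAt

theorem chartSymmDeriv_bijective [IsManifold (𝓡 m) ∞ M] (p : M) :
    Function.Bijective (chartSymmDeriv p (extChartAt (𝓡 m) p p)) := by
  have h := isInvertible_mfderivWithin_extChartAt_symm (I := 𝓡 m) (mem_extChartAt_target p)
  rw [show range (𝓡 m) = univ from ModelWithCorners.range_eq_univ _, mfderivWithin_univ] at h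
  obtain ⟨e, he⟩ := h
  have := e.bijective
  rw [chartSymmDeriv, ← he]
  exact this

variable [RiemannianBundle (fun p : M ↦ TangentSpace (𝓡 m) p)]

/-- The weighted Laplacian of `w` at `p` only depends on the germ of `w` at `p`, up to constants. -/
theorem weightedLaplacian_congr_sub_const {f w₁ w₂ : M → ℝ} {p : M} {b : ℝ}
    (h : w₁ =ᶠ[𝓝 p] fun q ↦ w₂ q - b) :
    weightedLaplacian m f w₁ p = weightedLaplacian m f w₂ p := by
  set y := extChartAt (𝓡 m) p p with hy
  have hev : w₁ ∘ (extChartAt (𝓡 m) p).symm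
      =ᶠ[𝓝 y] fun z ↦ (w₂ ∘ (extChartAt (𝓡 m) p).symm) z - b := by
    have hc : Tendsto (extChartAt (𝓡 m) p).symm (𝓝 y) (𝓝 p) := by
      have := continuousAt_extChartAt_symm (I := 𝓡 m) p
      rwa [ContinuousAt, extChartAt_to_inv] at this
    exact hc.eventually h
  have h1 (i : Fin m) : coordDeriv i (w₁ ∘ (extChartAt (𝓡 m) p).symm)
      =ᶠ[𝓝 y] coordDeriv i (w₂ ∘ (extChartAt (𝓡 m) p).symm) := by
    refine (coordDeriv_eventuallyEq hev i).trans (Eventually.of_forall fun z ↦ ?_)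
    simp only [coordDeriv, fderiv_sub_const]
  have h2 (i j : Fin m) := (coordDeriv_eventuallyEq (h1 j) i).self_of_nhds
  simp only [weightedLaplacian, traceHessInChart, gradInnerInChart, hessCoeff, ← hy, h2,
    fun i ↦ (h1 i).self_of_nhds]

/-- Coordinate derivatives commute with `ℓ`, and the Christoffel symbols depend on the metric alone.
With `ℓ = ⟨v, ·⟩` this turns the Hessian trace of the height into `⟨𝐇, v⟩`. -/
theorem traceHessInChart_clm_comp {F G : Type*} [NormedAddCommGroup F] [NormedSpace ℝ F]
    [NormedAddCommGroup G] [NormedSpace ℝ G] (ℓ : F →L[ℝ] G) {x : M → F} {c : M} {y : Euc m}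
    (hx : ContDiffAt ℝ 2 (x ∘ (extChartAt (𝓡 m) c).symm) y) :
    traceHessInChart (fun p ↦ ℓ (x p)) c y = ℓ (traceHessInChart x c y) := by
  set h := x ∘ (extChartAt (𝓡 m) c).symm with hh
  have hcomp : (fun p ↦ ℓ (x p)) ∘ (extChartAt (𝓡 m) c).symm = fun z ↦ ℓ (h z) := rfl
  have h1 (i : Fin m) : coordDeriv i (fun z ↦ ℓ (h z)) =ᶠ[𝓝 y] fun z ↦ ℓ (coordDeriv i h z) := by
    filter_upwards [hx.eventually (by simp)] with z hz
    exact coordDeriv_clm_comp ℓ (hz.differentiableAt (by simp)) i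
  have hd (i : Fin m) : DifferentiableAt ℝ (coordDeriv i h) y :=
    ((hx.fderiv_right (m := 1) (by norm_num)).differentiableAt (by simp)).clm_apply
      (differentiableAt_const _)
  have h2 (i j : Fin m) : coordDeriv i (coordDeriv j fun z ↦ ℓ (h z)) y
      = ℓ (coordDeriv i (coordDeriv j h) y) := by
    rw [(coordDeriv_eventuallyEq (h1 j) i).self_of_nhds, coordDeriv_clm_comp ℓ (hd j)]
  simp only [traceHessInChart, hessCoeff, hcomp, ← hh, h2, fun i ↦ (h1 i).self_of_nhds,
    map_sum, map_smul, map_sub]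

end Geometry

section Translator

variable {m : ℕ} {M : Type*} [EMetricSpace M] [ChartedSpace (Euc m) M]
  [RiemannianBundle (fun p : M ↦ TangentSpace (𝓡 m) p)]
  {x : M → Euc (m + 1)} {v : Euc (m + 1)}

theorem differential_injective (hx : IsTranslator m x v) (p : M) :
    Function.Injective (differential m x p) := by
  refine (injective_iff_map_eq_zero _).2 fun X hX ↦ ?_
  have h := hx.isometric p X X
  rw [hX, inner_zero_left] at h
  exact inner_self_eq_zero.1 h.symm

variable [IsManifold (𝓡 m) ∞ M]

theorem coordDeriv_comp_extChartAt_symm (hx : IsTranslator m x v) (p : M) (i : Fin m) :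
    coordDeriv i (x ∘ (extChartAt (𝓡 m) p).symm) (extChartAt (𝓡 m) p p)
      = differential m x ((extChartAt (𝓡 m) p).symm (extChartAt (𝓡 m) p p))
        (chartSymmDeriv p (extChartAt (𝓡 m) p p) (EuclideanSpace.single i 1)) := by
  have hs : MDifferentiableAt 𝓘(ℝ, Euc m) (𝓡 m) (extChartAt (𝓡 m) p).symm
      (extChartAt (𝓡 m) p p) :=
    ((contMDiffOn_extChartAt_symm (n := ∞) p).contMDiffAt
      (extChartAt_target_mem_nhds p)).mdifferentiableAt (by simp)
  have hc := mfderiv_comp (extChartAt (𝓡 m) p p)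
    (hx.smooth.mdifferentiableAt (by simp) (x := (extChartAt (𝓡 m) p).symm _)) hs
  rw [coordDeriv, ← mfderiv_eq_fderiv, hc]
  rfl

/-- The height function of a translator with respect to the direction of motion has weighted
Laplacian one. -/
theorem weightedLaplacian_height (hx : IsTranslator m x v) (p : M) :
    weightedLaplacian m (fun q ↦ -inner ℝ (x q) v) (fun q ↦ inner ℝ (x q) v) p = 1 := by
  set y := extChartAt (𝓡 m) p p with hy
  set h := x ∘ (extChartAt (𝓡 m) p).symm with hh
  have hsm : ContDiffAt ℝ ∞ h y := contDiffAt_comp_extChartAt_symm hx.smooth p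
  have hd : DifferentiableAt ℝ h y := hsm.differentiableAt (by simp)
  have hinner (q : Euc (m + 1)) : inner ℝ q v = innerSL ℝ v q := by
    rw [innerSL_apply_apply, real_inner_comm]
  have hpy : (extChartAt (𝓡 m) p).symm y = p := extChartAt_to_inv p
  let a : Fin m → Euc (m + 1) := fun i ↦ coordDeriv i h y
  have ha (i : Fin m) : a i = differential m x ((extChartAt (𝓡 m) p).symm y)
      (chartSymmDeriv p y (EuclideanSpace.single i 1)) :=
    coordDeriv_comp_extChartAt_symm hx p i
  have hmetric : metricCoeff p y = Matrix.gram ℝ a := by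
    ext i j
    rw [Matrix.gram_apply, ha, ha, hx.isometric]
    rfl
  let T : Euc m →ₗ[ℝ] Euc (m + 1) :=
    (differential m x ((extChartAt (𝓡 m) p).symm y)).toLinearMap ∘ₗ
      (chartSymmDeriv p y).toLinearMap
  have haT : a = T ∘ EuclideanSpace.basisFun (Fin m) ℝ := by
    ext1 i
    rw [ha, Function.comp_apply, EuclideanSpace.basisFun_apply]
    rfl
  have hTinj : Function.Injective T :=
    (differential_injective hx _).comp (chartSymmDeriv_bijective p).1
  have hli : LinearIndependent ℝ a := by
    rw [haT]
    have := (EuclideanSpace.basisFun (Fin m) ℝ).toBasis.linearIndependent.map' T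
      (LinearMap.ker_eq_bot.2 hTinj)
    simpa using this
  have hrange : LinearMap.range (differential m x p).toLinearMap = Submodule.span ℝ (range a) := by
    have h1 : Submodule.span ℝ (range a) = LinearMap.range T := by
      rw [haT, range_comp, Submodule.span_image,
        ← OrthonormalBasis.coe_toBasis, Module.Basis.span_eq, LinearMap.range_eq_map]
    have h2 : LinearMap.range T = LinearMap.range
        (differential m x ((extChartAt (𝓡 m) p).symm y)).toLinearMap :=
      LinearMap.range_comp_of_range_eq_top _
        (LinearMap.range_eq_top.2 (chartSymmDeriv_bijective p).2)
    rw [h1, h2, hpy]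
  set S := LinearMap.range (differential m x p).toLinearMap with hS
  have horth (s : Euc (m + 1)) (hs : s ∈ S) : inner ℝ v s = inner ℝ (S.starProjection v) s := by
    have := S.starProjection_inner_eq_zero v s hs
    rwa [inner_sub_left, sub_eq_zero] at this
  have hpyth : ‖Sᗮ.starProjection v‖ ^ 2 = inner ℝ v (Sᗮ.starProjection v) ∧
      inner ℝ v (Sᗮ.starProjection v) = ‖v‖ ^ 2 - ‖S.starProjection v‖ ^ 2 := by
    have := horth _ (S.starProjection_apply_mem v)
    rw [Submodule.starProjection_orthogonal_val, ← real_inner_self_eq_norm_sq,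
      ← real_inner_self_eq_norm_sq, ← real_inner_self_eq_norm_sq, inner_sub_sub_self,
      inner_sub_right, real_inner_comm v (S.starProjection v)]
    constructor <;> linarith
  have htrace : traceHessInChart (fun q ↦ inner ℝ (x q) v) p y = ‖Sᗮ.starProjection v‖ ^ 2 := by
    simp only [hinner]
    rw [traceHessInChart_clm_comp (innerSL ℝ v) (contDiffAt_infty.1 hsm 2)]
    have ht := hx.translator_eq p
    rw [meanCurvatureVector, normalPart] at ht
    rw [ht, innerSL_apply_apply, hpyth.1]
  -- Pairing `v` with the tangent vectors `a i` sees only its tangential part, so the Gram identity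
  -- applies to that part.
  have hgrad : gradInnerInChart (fun q ↦ -inner ℝ (x q) v) (fun q ↦ inner ℝ (x q) v) p y
      = -‖S.starProjection v‖ ^ 2 := by
    have hu (i : Fin m) : coordDeriv i ((fun q ↦ inner ℝ (x q) v) ∘ (extChartAt (𝓡 m) p).symm) y
        = inner ℝ (a i) (S.starProjection v) := by
      simp only [hinner]
      refine (coordDeriv_clm_comp (innerSL ℝ v) hd i).trans ?_
      rw [innerSL_apply_apply, real_inner_comm _ (a i)]
      exact horth _ (hrange ▸ Submodule.subset_span (mem_range_self i))
    have hf (i : Fin m) : coordDeriv i ((fun q ↦ -inner ℝ (x q) v) ∘ (extChartAt (𝓡 m) p).symm) y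
        = -inner ℝ (a i) (S.starProjection v) := by
      rw [← hu]
      simp only [coordDeriv]
      rw [← neg_apply, ← fderiv_neg]
      rfl
    simp only [gradInnerInChart, hu, hf, hmetric]
    rw [← sum_gram_inv_mul_inner_mul_inner hli
      (hrange ▸ Submodule.starProjection_apply_mem S v)]
    simp only [neg_mul, mul_neg, Finset.sum_neg_distrib]
  rw [weightedLaplacian, ← hy, htrace, hgrad, hpyth.1, hpyth.2, hx.norm_velocity]
  ring

end Translator

/-! ### Stochastic completeness against functions bounded above -/

section Main

variable {m : ℕ} {M : Type*} [EMetricSpace M] [SecondCountableTopology M]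
  [ChartedSpace (Euc m) M] [IsManifold (𝓡 m) ∞ M]
  [RiemannianBundle (fun p : M ↦ TangentSpace (𝓡 m) p)]

/-- A function with weighted Laplacian one that is bounded above by `b` is at most `b - t` at the
starting point of a diffusion, up to the probability of leaving a compact set before time `t`. -/
theorem sub_le_neg_mul_measureReal_stays {f u : M → ℝ} {p : M}
    {Ω : Type*} [mΩ : MeasurableSpace Ω] {P : Measure Ω} {ℱ : Filtration ℝ≥0 mΩ}
    {X : ℝ≥0 → Ω → M} (hX : IsDiffusionFrom m f p P ℱ X)
    (hu : ContMDiff (𝓡 m) 𝓘(ℝ, ℝ) ∞ u) (hΔ : ∀ q, weightedLaplacian m f u q = 1) {b : ℝ}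
    (hub : ∀ q, u q ≤ b) {K : Set M} (hK : IsCompact K) (hp : p ∈ K) (t : ℝ≥0) :
    u p - b ≤ -(t * P.real {o | ∀ s ≤ t, X s o ∈ K}) := by
  have := hX.isProbabilityMeasure
  have : LocallyCompactSpace M := Manifold.locallyCompact_of_finiteDimensional (𝓡 m)
  obtain ⟨K', hK', hKK'⟩ := exists_compact_superset hK
  obtain ⟨φ, hφ1, hφ0, hφ⟩ := exists_contMDiffMap_one_nhds_of_subset_interior (n := ⊤) (𝓡 m)
    hK.isClosed hKK'
  obtain ⟨U, hU, hKU, hUφ⟩ := eventually_nhdsSet_iff_exists.1 hφ1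
  let ψ : M → ℝ := fun q ↦ φ q * (u q - b)
  have hψ : ContMDiff (𝓡 m) 𝓘(ℝ, ℝ) ∞ ψ := φ.contMDiff.mul (hu.sub contMDiff_const)
  have hψc : HasCompactSupport ψ := HasCompactSupport.intro hK' fun q hq ↦ by simp [ψ, hφ0 q hq]
  have hψ0 (q : M) : ψ q ≤ 0 := mul_nonpos_of_nonneg_of_nonpos (hφ q).1 (by linarith [hub q])
  have hψΔ (q : M) (hq : q ∈ U) : weightedLaplacian m f ψ q = 1 := by
    rw [← hΔ q]
    refine weightedLaplacian_congr_sub_const (b := b) ?_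
    filter_upwards [hU.mem_nhds hq] with z hz
    simp [ψ, hUφ z hz]
  have hmain := integral_le_neg_mul_measureReal hX.adapted hX.continuous_paths
    (hX.martingale ψ hψ hψc) hK hU hKU (fun o ↦ by simpa using hψ0 _) (fun o r hr ↦ ?_)
    (measurableSet_forall_le_mem (fun s ↦ (hX.adapted s).mono (ℱ.le s) le_rfl)
      hX.continuous_paths hK.isClosed t) (fun o ho ↦ ho)
  · have hstart : (fun o ↦ ψ (X 0 o) - ∫ s in (0 : ℝ)..(0 : ℝ≥0),
        weightedLaplacian m f ψ (X s.toNNReal o)) =ᵐ[P] fun _ ↦ u p - b := by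
      filter_upwards [hX.start] with o ho
      simp [ho, ψ, hUφ p (hKU hp)]
    rwa [integral_congr_ae hstart, integral_const, probReal_univ, one_smul] at hmain
  · have hint : ∫ s in (0 : ℝ)..r, weightedLaplacian m f ψ (X s.toNNReal o) = r := by
      rw [intervalIntegral.integral_congr (g := fun _ ↦ (1 : ℝ))]
      · simp
      · intro s hs
        rw [uIcc_of_le r.coe_nonneg] at hs
        exact hψΔ _ (hr _ (Real.toNNReal_le_iff_le_coe.2 hs.2))
    rw [hint]
    linarith [hψ0 (X r o)]

/-- On a stochastically complete weighted manifold, a function with weighted Laplacian one is not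
bounded above. -/
theorem not_forall_le_of_weightedLaplacian_eq_one [Nonempty M] {f u : M → ℝ}
    (hf : IsStochasticallyComplete m f)
    (hu : ContMDiff (𝓡 m) 𝓘(ℝ, ℝ) ∞ u) (hΔ : ∀ q, weightedLaplacian m f u q = 1) (b : ℝ) :
    ¬ ∀ q, u q ≤ b := by
  intro hub
  obtain ⟨p⟩ := ‹Nonempty M›
  obtain ⟨Ω, mΩ, P, ℱ, X, hX⟩ := hf p
  have := hX.isProbabilityMeasure
  have : LocallyCompactSpace M := Manifold.locallyCompact_of_finiteDimensional (𝓡 m)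
  let K : CompactExhaustion M := CompactExhaustion.choice M
  have hle (t : ℝ≥0) : u p - b ≤ -t := by
    let A : ℕ → Set Ω := fun n ↦ {o | ∀ s ≤ t, X s o ∈ K n}
    have hmono : Monotone A := fun i j hij o ho s hs ↦ K.subset hij (ho s hs)
    have hunion : ⋃ n, A n = univ := by
      refine eq_univ_of_forall fun o ↦ mem_iUnion.2 ?_
      obtain ⟨n, hn⟩ := K.exists_superset_of_isCompact
        ((isCompact_Icc (a := 0) (b := t)).image (hX.continuous_paths o))
      exact ⟨n, fun s hs ↦ hn ⟨s, ⟨zero_le, hs⟩, rfl⟩⟩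
    have hlim : Tendsto (fun n ↦ P.real (A n)) atTop (𝓝 1) := by
      have h := tendsto_measure_iUnion_atTop (μ := P) hmono
      rw [hunion, measure_univ] at h
      exact (ENNReal.tendsto_toReal ENNReal.one_ne_top).comp h
    have hlim' := (hlim.const_mul (t : ℝ)).neg
    rw [mul_one] at hlim'
    obtain ⟨n₀, hn₀⟩ := K.exists_mem p
    refine ge_of_tendsto hlim' ?_
    filter_upwards [eventually_ge_atTop n₀] with n hn
    exact sub_le_neg_mul_measureReal_stays hX hu hΔ hub (K.isCompact n) (K.subset hn hn₀) t
  -- Any `t > b - u p` contradicts `u p - b ≤ -t`.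
  have h := hle (b - u p + 1).toNNReal
  rw [Real.coe_toNNReal _ (by linarith [hub p])] at h
  linarith

end Main

end TranslatorMCF

theorem mainTheorem9 (m : ℕ) (M : Type*) [EMetricSpace M] [SecondCountableTopology M]
    [ChartedSpace (TranslatorMCF.Euc m) M] [IsManifold (𝓡 m) ∞ M]
    [RiemannianBundle (fun p : M ↦ TangentSpace (𝓡 m) p)]
    [IsContMDiffRiemannianBundle (𝓡 m) ∞ (TranslatorMCF.Euc m)
      (fun p : M ↦ TangentSpace (𝓡 m) p)]
    [IsRiemannianManifold (𝓡 m) M]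
    (x : M → TranslatorMCF.Euc (m + 1)) (v : TranslatorMCF.Euc (m + 1))
    (hx : TranslatorMCF.IsTranslator m x v)
    (hstoch : TranslatorMCF.IsStochasticallyComplete m (fun p : M ↦ -inner ℝ (x p) v)) :
    (∀ b : ℝ, ¬ Set.range x ⊆ {q | inner ℝ q v ≤ b}) ∧
      ¬ Bornology.IsBounded (Set.range x) := by
  have := hx.connected
  have hsm : ContMDiff (𝓡 m) 𝓘(ℝ, ℝ) ∞ fun p : M ↦ inner ℝ (x p) v :=
    (contDiff_id.inner ℝ contDiff_const).contMDiff.comp hx.smooth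
  have hhalf (b : ℝ) : ¬ Set.range x ⊆ {q | inner ℝ q v ≤ b} := fun hb ↦
    TranslatorMCF.not_forall_le_of_weightedLaplacian_eq_one hstoch hsm
      (TranslatorMCF.weightedLaplacian_height hx) b fun q ↦ hb (mem_range_self q)
  refine ⟨hhalf, fun hbdd ↦ ?_⟩
  obtain ⟨R, hR⟩ := hbdd.exists_norm_le
  refine hhalf R fun q hq ↦ ?_
  have h := real_inner_le_norm q v
  rw [hx.norm_velocity, mul_one] at h
  exact h.trans (hR q hq)
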